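/- **Proposition 4.3.** Let $0 < a \le 1$. Put $S(x) = \frac{\sin \pi x}{\pi x}$ for $x \ne 0$ and $S(0) = 1$. A *configuration* in $a\mathbb{Z}$ is a sequence $u = (u_j)_{j \in \mathbb{Z}}$ of elements of $a\mathbb{Z}$ such that every compact interval contains $u_j$ for only finitely many indices $j$; for $V \subseteq a\mathbb{Z}$ put $\#_V(u) = \#\{j \in \mathbb{Z} : u_j \in V\}$. The space of configurations carries the Borel $\sigma$-algebra of the smallest topology containing all the sets $\{u : \#_{\{x\}}(u) = n\}$ with $x \in a\mathbb{Z}$ and $n = 0, 1, 2, \dots$; a *point process* on $a\mathbb{Z}$ is a random element of this space, defined on some probability space. Let $w = (w_j)_{j\in\mathbb{Z}}$ be an $a$-discrete sine process, that is, a point process on $a\mathbb{Z}$ such that for every $n \ge 1$ and every continuous compactly supported $\varphi : \mathbb{R}^n \to \mathbb{C}$ the following expectation is finite (the sum is an integrable random variable) and $$ \mathbb{E} \sum_{\substack{j_1, \dots, j_n \in \mathbb{Z} \\ \text{distinct}}} \varphi(w_{j_1}, \dots, w_{j_n}) = a^n \sum_{k \in (a\mathbb{Z})^n} \varphi(k)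 \det_{1 \le i, j \le n}\big[ S(k_i - k_j) \big]. $$ Then $w$ is simple: the probability that there is an $x \in a\mathbb{Z}$ with $\#_{\{x\}}(w) \ge 2$ is zero; that is, almost surely no site of $a\mathbb{Z}$ is occupied twice. -/

import Mathlib

open MeasureTheory

namespace DiscreteSine

/-- The lattice `aℤ = {…, -a, 0, a, …} ⊆ ℝ`, with the topology induced by `ℝ`. -/
abbrev Site (a : ℝ) : Type := AddSubgroup.zmultiples a

/-- A locally finite configuration in `aℤ`: a sequence `(u_j)` of elements of `aℤ`, indexed by
`j ∈ ℤ`, only finitely many of which lie in any given compact interval. -/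
structure Conf (a : ℝ) where
  /-- The points of the configuration. -/
  pt : ℤ → Site a
  /-- Every compact interval contains only finitely many members of the sequence. -/
  locallyFinite : ∀ s t : ℝ, {j : ℤ | (pt j : ℝ) ∈ Set.Icc s t}.Finite

/-- `#_V(u)`: the number of indices `j` with `u_j ∈ V` (members of the sequence are counted with
multiplicity). -/
noncomputable def Conf.count {a : ℝ} (u : Conf a) (V : Set (Site a)) : ℕ∞ :=
  {j : ℤ | u.pt j ∈ V}.encard

/-- The cylinder set of the configurations `u` with `#_V(u) = n`. -/
def Conf.cylinder {a : ℝ} (n : ℕ) (V : Set (Site a)) : Set (Conf a) :=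
  {u | u.count V = n}

/-- The smallest topology on the configurations in `aℤ` that contains the cylinder sets over the
singletons. -/
instance (a : ℝ) : TopologicalSpace (Conf a) :=
  TopologicalSpace.generateFrom {C | ∃ (n : ℕ) (x : Site a), C = Conf.cylinder n {x}}

/-- The configurations carry the Borel σ-algebra. -/
instance (a : ℝ) : MeasurableSpace (Conf a) := borel (Conf a)

instance (a : ℝ) : BorelSpace (Conf a) := ⟨rfl⟩

/-- A point process on `aℤ`, defined on the probability space `(Ω, P)`: a random element of the
space of configurations. -/
def IsPointProcess {a : ℝ} {Ω : Type*} [MeasurableSpace Ω] (P : Measure Ω) (u : Ω → Conf a) :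
    Prop :=
  IsProbabilityMeasure P ∧ Measurable u

/-- The sum of `φ(u_{j_1}, …, u_{j_n})` over all pairwise distinct indices `j_1, …, j_n ∈ ℤ`.
It has only finitely many non-zero terms if `φ` is compactly supported. -/
noncomputable def Conf.distinctSum {a : ℝ} {n : ℕ} (u : Conf a) (φ : (Fin n → ℝ) → ℂ) : ℂ :=
  ∑' j : Fin n ↪ ℤ, φ (fun i => (u.pt (j i) : ℝ))

/-- `ρ` is the `n`-point correlation function of the process `u` on `aℤ`: for every
`φ ∈ C_c(ℝⁿ)`, the sum of `φ` over distinct indices has a finite expectation, equal to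
`aⁿ ∑_{k ∈ (aℤ)ⁿ} φ(k) ρ(k)`. -/
def IsCorrelationFunction {a : ℝ} {Ω : Type*} [MeasurableSpace Ω] (P : Measure Ω)
    (u : Ω → Conf a) (n : ℕ) (ρ : (Fin n → Site a) → ℂ) : Prop :=
  ∀ φ : (Fin n → ℝ) → ℂ, Continuous φ → HasCompactSupport φ →
    Integrable (fun ω => (u ω).distinctSum φ) P ∧
    ∫ ω, (u ω).distinctSum φ ∂P =
      (a : ℂ) ^ n * ∑' k : Fin n → Site a, φ (fun i => (k i : ℝ)) * ρ k

/-- `S(x) = sin(πx) / (πx)`, with `S(0) = 1`. -/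
noncomputable def S (x : ℝ) : ℝ := Real.sinc (Real.pi * x)

/-- The `a`-discrete sine process: the point process on `aℤ` whose `n`-point correlation function
is `det[S(k_i - k_j)]` for every `n ≥ 1`. -/
def IsDiscreteSineProcess (a : ℝ) {Ω : Type*} [MeasurableSpace Ω] (P : Measure Ω)
    (w : Ω → Conf a) : Prop :=
  IsPointProcess P w ∧
  ∀ n : ℕ, 1 ≤ n → IsCorrelationFunction P w n (fun k =>
    ((Matrix.of fun i j : Fin n => S ((k i : ℝ) - (k j : ℝ))).det : ℂ))

/-- A point process is simple if the event that some site is occupied by at least two members of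
the configuration has probability zero. -/
def IsSimple {a : ℝ} {Ω : Type*} [MeasurableSpace Ω] (P : Measure Ω) (u : Ω → Conf a) : Prop :=
  P {ω | ∃ x : Site a, 2 ≤ (u ω).count {x}} = 0

end DiscreteSine

namespace DiscreteSine

/-! On the diagonal the two-point determinant is $S(0)^2 - S(0)^2 = 0$. Tested against a tent that
isolates $(x,x)$ among lattice pairs, the correlation identity says that a nonnegative sum has
expectation zero, so the sum vanishes almost surely. It is positive when $x$ is doubly occupied
(`Conf.tsum_tent_pos`), and there are only countably many sites. -/

/-- The tent function of width `r` around the point `(x, …, x)`. -/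
noncomputable def tent (r x : ℝ) {n : ℕ} (y : Fin n → ℝ) : ℝ :=
  max 0 (1 - dist y (fun _ => x) / r)

lemma tent_nonneg (r x : ℝ) {n : ℕ} (y : Fin n → ℝ) : 0 ≤ tent r x y := le_max_left _ _

@[simp] lemma tent_center (r x : ℝ) (n : ℕ) : tent r x (fun _ : Fin n => x) = 1 := by
  simp [tent]

lemma tent_eq_zero {r x : ℝ} (hr : 0 < r) {n : ℕ} {y : Fin n → ℝ}
    (h : r ≤ dist y (fun _ => x)) : tent r x y = 0 := by
  rw [tent, max_eq_left]
  rw [sub_nonpos]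
  exact (one_le_div hr).2 h

lemma continuous_tent (r x : ℝ) (n : ℕ) : Continuous (tent r x : (Fin n → ℝ) → ℝ) := by
  unfold tent
  fun_prop

lemma hasCompactSupport_tent {r : ℝ} (hr : 0 < r) (x : ℝ) (n : ℕ) :
    HasCompactSupport (tent r x : (Fin n → ℝ) → ℝ) := by
  refine HasCompactSupport.intro (isCompact_closedBall (fun _ => x) r) fun y hy => ?_
  exact tent_eq_zero hr (not_le.1 hy).le

/-- Distinct points of `aℤ` are at distance at least `a`. -/
lemma Site.le_dist {a : ℝ} (ha : 0 < a) {x y : Site a} (h : x ≠ y) :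
    a ≤ dist (x : ℝ) (y : ℝ) := by
  obtain ⟨_, m, rfl⟩ := x
  obtain ⟨_, k, rfl⟩ := y
  have hmk : m - k ≠ 0 := fun h0 => h (by simp [sub_eq_zero.1 h0])
  have h1 : (1 : ℝ) ≤ |((m - k : ℤ) : ℝ)| := by exact_mod_cast Int.one_le_abs hmk
  simp only [zsmul_eq_mul, Real.dist_eq, ← sub_mul, abs_mul, abs_of_pos ha]
  push_cast at h1
  nlinarith

lemma tent_site_eq_zero {a : ℝ} (ha : 0 < a) (x : Site a) {n : ℕ} {k : Fin n → Site a}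
    (h : k ≠ fun _ => x) : tent a (x : ℝ) (fun i => (k i : ℝ)) = 0 := by
  obtain ⟨i, hi⟩ := Function.ne_iff.1 h
  exact tent_eq_zero ha ((Site.le_dist ha hi).trans
    (dist_le_pi_dist (fun i => (k i : ℝ)) (fun _ => (x : ℝ)) i))

lemma Conf.finite_fiber {a : ℝ} (u : Conf a) (x : Site a) : {j : ℤ | u.pt j = x}.Finite :=
  (u.locallyFinite x x).subset fun j (hj : u.pt j = x) => by simp [hj]

/-- A nonzero term has all its indices in the fiber over `x`, which is finite by local finiteness.
Summability matters because `tsum` defaults to 0 on divergent families. -/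
lemma Conf.summable_tent {a : ℝ} (ha : 0 < a) (u : Conf a) (x : Site a) (n : ℕ) :
    Summable fun j : Fin n ↪ ℤ => tent a (x : ℝ) (fun i => (u.pt (j i) : ℝ)) := by
  refine summable_of_hasFiniteSupport ?_
  refine ((Set.Finite.pi' fun _ : Fin n => u.finite_fiber x).preimage
    (DFunLike.coe_injective (F := Fin n ↪ ℤ)).injOn).subset fun j hj => ?_
  by_contra hne
  refine hj (tent_site_eq_zero ha x (k := fun i => u.pt (j i)) fun h => hne fun i => ?_)
  exact congrFun h i

lemma Conf.tsum_tent_pos {a : ℝ} (ha : 0 < a) (u : Conf a) (x : Site a)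
    (h : 2 ≤ u.count {x}) :
    0 < ∑' j : Fin 2 ↪ ℤ, tent a (x : ℝ) (fun i => (u.pt (j i) : ℝ)) := by
  have h1 : 1 < {j : ℤ | u.pt j ∈ ({x} : Set (Site a))}.encard :=
    lt_of_lt_of_le (by norm_num) h
  obtain ⟨p, q, hp, hq, hpq⟩ := Set.one_lt_encard_iff.1 h1
  have hinj : Function.Injective ![p, q] := by
    intro i j hij
    fin_cases i <;> fin_cases j <;> simp_all
  refine (u.summable_tent ha x 2).tsum_pos (fun _ => tent_nonneg _ _ _) ⟨![p, q], hinj⟩ ?_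
  have : (fun i => (u.pt (![p, q] i) : ℝ)) = fun _ => (x : ℝ) := by
    funext i
    fin_cases i
    · exact congrArg Subtype.val hp
    · exact congrArg Subtype.val hq
  simp [this]

/-- If the two-point correlation function vanishes on the diagonal, the process is simple. -/
lemma IsCorrelationFunction.isSimple {a : ℝ} (ha : 0 < a) {Ω : Type*} [MeasurableSpace Ω]
    {P : Measure Ω} {u : Ω → Conf a} {ρ : (Fin 2 → Site a) → ℂ}
    (hu : IsCorrelationFunction P u 2 ρ) (hρ : ∀ x, ρ (fun _ => x) = 0) : IsSimple P u := by
  have : Countable (Site a) :=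
    (Set.countable_range fun m : ℤ => m • a).to_subtype
  rw [IsSimple, Set.ofPred_exists, measure_iUnion_null_iff]
  intro x
  -- A real-valued copy of the complex sum, so that nonnegativity can be used.
  set F : Ω → ℝ := fun ω => ∑' j : Fin 2 ↪ ℤ, tent a (x : ℝ) (fun i => ((u ω).pt (j i) : ℝ))
  have hF : ∀ ω, (u ω).distinctSum (fun y => (tent a (x : ℝ) y : ℂ)) = (F ω : ℂ) :=
    fun ω => (Complex.ofReal_tsum _).symm
  obtain ⟨hint, heq⟩ := hu (fun y => (tent a (x : ℝ) y : ℂ))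
    (Complex.continuous_ofReal.comp (continuous_tent a x 2))
    ((hasCompactSupport_tent ha x 2).comp_left Complex.ofReal_zero)
  have hzero : ∀ k : Fin 2 → Site a,
      (tent a (x : ℝ) (fun i => (k i : ℝ)) : ℂ) * ρ k = 0 := by
    intro k
    by_cases hk : k = fun _ => x
    · rw [hk, hρ, mul_zero]
    · rw [tent_site_eq_zero ha x hk, Complex.ofReal_zero, zero_mul]
  simp only [hF, hzero, tsum_zero, mul_zero] at hint heq
  have hFint : Integrable F P := by simpa using hint.re
  have hF0 : ∫ ω, F ω ∂P = 0 := by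
    rw [integral_complex_ofReal] at heq
    exact_mod_cast heq
  have hae := (integral_eq_zero_iff_of_nonneg
    (fun ω => tsum_nonneg fun _ => tent_nonneg _ _ _) hFint).1 hF0
  exact measure_mono_null (fun ω hω => ((u ω).tsum_tent_pos ha x hω).ne') hae

end DiscreteSine

theorem proposition4p3 (a : ℝ) (ha0 : 0 < a) (ha1 : a ≤ 1)
    {Ω : Type*} [MeasurableSpace Ω] (P : MeasureTheory.Measure Ω)
    (w : Ω → DiscreteSine.Conf a) (hw : DiscreteSine.IsDiscreteSineProcess a P w) :
    DiscreteSine.IsSimple P w := by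
  refine (hw.2 2 one_le_two).isSimple ha0 fun x => ?_
  simp [Matrix.det_fin_two]
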